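/- Let $(X,d,\mathfrak m)$ be a metric measure space: $(X,d)$ is a complete separable metric space and $\mathfrak m$ is a locally finite non-negative Borel (hence Radon) measure with full support. Let $\mathcal P_2(X)$ be the set of Borel probability measures on $X$ with finite second moment, equipped with the $L^2$-Wasserstein distance $W_2$, and for $\mu\in\mathcal P_2(X)$ let $\mathrm{Ent}_{\mathfrak m}(\mu)=\int\rho\ln\rho\,d\mathfrak m$ if $\mu=\rho\,\mathfrak m$ (understood as $+\infty$ if the positive part of $\rho\ln\rho$ is not integrable) and $\mathrm{Ent}_{\mathfrak m}(\mu)=+\infty$ otherwise. Assume that $X$ is non-compact and that $(X,d,\mathfrak m)$ satisfies $\mathrm{CD}(0,\infty)$: for all $\mu_0,\mu_1\in\mathcal P_2(X)$ there is a $W_2$-geodesic $(\mu_t)_{t\in[0,1]}$ in $\mathcal P_2(X)$ from $\mu_0$ to $\mu_1$ such that $$\mathrm{Ent}_{\mathfrak m}(\mu_t)\le t\,\mathrm{Ent}_{\mathfrak m}(\mu_1)+(1-t)\,\mathrm{Ent}_{\mathfrak m}(\mu_0)\qquad\text{for all }t\in[0,1].$$ Then the volume entropy of $(X,d,\mathfrak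 m)$ exists and does not depend on the base point: there is $h\in[0,\infty]$ such that for every $x_0\in X$ $$\lim_{r\to+\infty}\frac{\ln\mathfrak m(B_r(x_0))}{r}=h,\qquad B_r(x_0)=\{x\in X: d(x,x_0)<r\}.$$ -/

import Mathlib

open MeasureTheory Filter Topology Set
open scoped ENNReal

noncomputable section

namespace VolEntropy

variable {X : Type*} [MetricSpace X] [MeasurableSpace X]

/-- Membership in `𝒫₂(X)`: a Borel probability measure with finite second moment. -/
structure IsP2 (μ : Measure X) : Prop where
  isProbabilityMeasure : IsProbabilityMeasure μ
  finite_second_moment : ∃ x₀ : X, ∫⁻ x, edist x x₀ ^ 2 ∂μ < ∞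

/-- `π` is a coupling (transport plan) of `μ` and `ν`: its two marginals are `μ` and `ν`. -/
structure IsCoupling (π : Measure (X × X)) (μ ν : Measure X) : Prop where
  fst_eq : π.map Prod.fst = μ
  snd_eq : π.map Prod.snd = ν

/-- The `L²`-Wasserstein distance
`W₂(μ, ν) = (inf_π ∫ d(x, y)² dπ(x, y))^{1/2}`, the infimum over all couplings. -/
def W2 (μ ν : Measure X) : ℝ≥0∞ :=
  (⨅ (π : Measure (X × X)) (_ : IsCoupling π μ ν), ∫⁻ p, edist p.1 p.2 ^ 2 ∂π) ^ (1 / 2 : ℝ)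

/-- `(γ t)_{t ∈ [0,1]}` is a (minimal, constant speed) geodesic of `(𝒫₂(X), W₂)` from `μ₀` to
`μ₁`. Values of `γ` outside `[0,1]` play no role. -/
structure IsW2Geodesic (γ : ℝ → Measure X) (μ₀ μ₁ : Measure X) : Prop where
  mem : ∀ t ∈ Icc (0 : ℝ) 1, IsP2 (γ t)
  start : γ 0 = μ₀
  finish : γ 1 = μ₁
  dist_eq : ∀ s ∈ Icc (0 : ℝ) 1, ∀ t ∈ Icc (0 : ℝ) 1,
    W2 (γ s) (γ t) = ENNReal.ofReal |t - s| * W2 μ₀ μ₁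

open scoped Classical in
/-- The relative entropy `Ent_m(μ) = ∫ ρ ln ρ dm ∈ [-∞, ∞]` if `μ = ρ m`, and `+∞` otherwise.
The integral is the integral of the positive part of `ρ ln ρ` minus the integral of its negative
part; it is `+∞` whenever the positive part is not integrable. -/
def relEntropy (m μ : Measure X) : EReal :=
  if μ ≪ m ∧
      ∫⁻ x, ENNReal.ofReal ((μ.rnDeriv m x).toReal * Real.log (μ.rnDeriv m x).toReal) ∂m ≠ ∞ then
    ((∫⁻ x, ENNReal.ofReal
        ((μ.rnDeriv m x).toReal * Real.log (μ.rnDeriv m x).toReal) ∂m : ℝ≥0∞) : EReal) -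
      ((∫⁻ x, ENNReal.ofReal
        (-((μ.rnDeriv m x).toReal * Real.log (μ.rnDeriv m x).toReal)) ∂m : ℝ≥0∞) : EReal)
  else ⊤

/-- The `CD(0, ∞)` condition (non-negative Ricci curvature in the sense of Lott, Sturm and
Villani): the entropy is displacement convex on `(𝒫₂(X), W₂)`. -/
def IsCDZeroInfty (m : Measure X) : Prop :=
  ∀ μ₀ μ₁ : Measure X, IsP2 μ₀ → IsP2 μ₁ →
    ∃ γ : ℝ → Measure X, IsW2Geodesic γ μ₀ μ₁ ∧
      ∀ t ∈ Icc (0 : ℝ) 1,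
        relEntropy m (γ t) ≤
          (t : EReal) * relEntropy m μ₁ + ((1 - t : ℝ) : EReal) * relEntropy m μ₀

/-- `h ∈ [0, ∞]` is the volume entropy computed at the base point `x₀`: the limit
`lim_{r → ∞} ln m(B_r(x₀)) / r` exists in the extended reals and equals `h`
(with `ln ∞ = ∞` and `ln 0 = -∞`; `B_r(x₀)` is the open ball). -/
def HasVolumeEntropyAt (m : Measure X) (x₀ : X) (h : ℝ≥0∞) : Prop :=
  Tendsto (fun r : ℝ => ENNReal.log (m (Metric.ball x₀ r)) / (r : EReal)) atTop
    (𝓝 (h : EReal))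

end VolEntropy

end

/-! Write `v s = log m(B_s(x₀))`. Displacement convexity of the entropy, applied between the uniform
measures on `B_r(x₀)` and on a set `A ⊆ B_R(x₀)`, yields the Brunn–Minkowski bound `(1 - t) v r + t
log m(A) ≤ v s` whenever `s > r + t (r + R)` (`IsCDZeroInfty.log_measure_ball_le`). Two facts give
it: the measure at time `t` lives on `B_s(x₀)`, and by Jensen its entropy is at least `-v s`.

With `t` small and `m(A)` large, the bound forces every ball to have finite measure. With `A =
B_R(x₀)` it makes `(v s - v r) / (s - r)` almost decreasing in `s`, so the quotient converges to its
infimum, a finite number. Inclusions between balls with different centres make the limit independent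
of the base point. -/

noncomputable section

namespace VolEntropy

/-! ### Gluing of transport plans and weighted square inequalities -/

section Gluing

variable {α β γ : Type*} [MeasurableSpace α] [MeasurableSpace β] [MeasurableSpace γ]

open ProbabilityTheory in
/-- Gluing lemma: two finite measures on products with a common marginal on the shared factor
are the two-dimensional marginals of one measure on the triple product. -/
theorem exists_glue [StandardBorelSpace α] [Nonempty α] [StandardBorelSpace γ] [Nonempty γ]
    (π₁ : Measure (α × β)) (π₂ : Measure (β × γ)) [IsFiniteMeasure π₁] [IsFiniteMeasure π₂]
    (h : π₁.map Prod.snd = π₂.map Prod.fst) :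
    ∃ P : Measure (α × β × γ), P.map (fun p => (p.1, p.2.1)) = π₁ ∧ P.map Prod.snd = π₂ := by
  let σ := π₁.map Prod.swap
  have hσ : σ.fst = π₂.fst := by
    simp only [σ, Measure.fst]
    rw [Measure.map_map measurable_fst measurable_swap, ← h]
    rfl
  -- The outer coordinates are taken conditionally independent given the shared one.
  let Q : Measure (β × α × γ) := π₂.fst ⊗ₘ (σ.condKernel ×ₖ π₂.condKernel)
  have h1 : Q.map (Prod.map id Prod.fst) = σ := by
    rw [← Measure.compProd_map measurable_fst, ← Kernel.fst_eq, Kernel.fst_prod, ← hσ]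
    exact σ.disintegrate σ.condKernel
  have h2 : Q.map (Prod.map id Prod.snd) = π₂ := by
    rw [← Measure.compProd_map measurable_snd, ← Kernel.snd_eq, Kernel.snd_prod]
    exact π₂.disintegrate π₂.condKernel
  refine ⟨Q.map (fun q => (q.2.1, q.1, q.2.2)), ?_, ?_⟩
  · rw [Measure.map_map (by fun_prop) (by fun_prop)]
    have : π₁ = σ.map Prod.swap := by
      simp only [σ]
      rw [Measure.map_map measurable_swap measurable_swap]
      simp
    rw [this, ← h1, Measure.map_map (by fun_prop) (by fun_prop)]
    rfl
  · rw [Measure.map_map (by fun_prop) (by fun_prop)]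
    exact h2

end Gluing

theorem sq_le_sq_div_add_sq_div {t a b c : ℝ} (ht0 : 0 < t) (ht1 : t < 1) (hc : 0 ≤ c)
    (hcab : c ≤ a + b) : c ^ 2 ≤ 1 / t * a ^ 2 + 1 / (1 - t) * b ^ 2 := by
  have h1 : 0 < 1 - t := by linarith
  have key : 1 / t * a ^ 2 + 1 / (1 - t) * b ^ 2 - (a + b) ^ 2
      = (a * (1 - t) - b * t) ^ 2 / (t * (1 - t)) := by
    field_simp
    ring
  have : 0 ≤ (a * (1 - t) - b * t) ^ 2 / (t * (1 - t)) := by positivity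
  nlinarith [pow_le_pow_left₀ hc hcab 2]

/-- Quantitative form of `sq_le_sq_div_add_sq_div` away from the equality case `a = t c`. -/
theorem sq_add_le_sq_div_add_sq_div {t a b c D η : ℝ} (ht0 : 0 < t) (ht1 : t < 1) (hc : 0 ≤ c)
    (hcab : c ≤ a + b) (hcD : c ≤ D) (hη : 0 ≤ η) (ha : t * D + η ≤ a) :
    c ^ 2 + (1 - t) / t * η ^ 2 ≤ 1 / t * a ^ 2 + 1 / (1 - t) * b ^ 2 := by
  have h1 : 0 < 1 - t := by linarith
  have hη' : η ≤ a - t * c := by nlinarith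
  have hsq : η ^ 2 ≤ (a - t * c) ^ 2 := pow_le_pow_left₀ hη hη' 2
  have hsq' : (1 - t) / t * η ^ 2 ≤ (1 - t) / t * (a - t * c) ^ 2 :=
    mul_le_mul_of_nonneg_left hsq (by positivity)
  -- If `a ≤ c`, then `b ≥ c - a ≥ 0` can be squared; otherwise the `a ^ 2` term alone suffices.
  rcases le_total a c with hac | hac
  · have hb' : 1 / (1 - t) * (c - a) ^ 2 ≤ 1 / (1 - t) * b ^ 2 := by
      apply mul_le_mul_of_nonneg_left _ (by positivity)
      exact pow_le_pow_left₀ (by linarith) (by linarith) 2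
    have key : 1 / t * a ^ 2 + 1 / (1 - t) * (c - a) ^ 2 - c ^ 2 - (1 - t) / t * (a - t * c) ^ 2
        = (2 - t) / (1 - t) * (a - t * c) ^ 2 := by
      field_simp
      ring
    have : 0 ≤ (2 - t) / (1 - t) * (a - t * c) ^ 2 :=
      mul_nonneg (div_nonneg (by linarith) h1.le) (sq_nonneg _)
    linarith
  · have hb' : 0 ≤ 1 / (1 - t) * b ^ 2 := by positivity
    have e : (a - t * c) ^ 2 ≤ a ^ 2 := by
      apply pow_le_pow_left₀ (hη.trans hη')
      nlinarith
    have e' := mul_le_mul_of_nonneg_left e (show 0 ≤ (1 - t) / t by positivity)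
    have e2 : (1 - t) / t * a ^ 2 = 1 / t * a ^ 2 - a ^ 2 := by field_simp
    have e3 : c ^ 2 ≤ a ^ 2 := pow_le_pow_left₀ hc hac 2
    linarith

theorem edist_sq_eq_ofReal {X : Type*} [PseudoMetricSpace X] (x y : X) :
    edist x y ^ 2 = ENNReal.ofReal (dist x y ^ 2) := by
  rw [edist_dist, ENNReal.ofReal_pow dist_nonneg]

/-! ### Quadratic transport cost and supports of Wasserstein geodesics -/

section Transport

variable {X : Type*} [MetricSpace X] [MeasurableSpace X]

/-- The infimum of the quadratic transport costs between two measures. -/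
def transportCost (μ ν : Measure X) : ℝ≥0∞ :=
  ⨅ (π : Measure (X × X)) (_ : IsCoupling π μ ν), ∫⁻ p, edist p.1 p.2 ^ 2 ∂π

theorem transportCost_le {μ ν : Measure X} {π : Measure (X × X)} (h : IsCoupling π μ ν) :
    transportCost μ ν ≤ ∫⁻ p, edist p.1 p.2 ^ 2 ∂π :=
  iInf₂_le π h

theorem W2_eq (μ ν : Measure X) : W2 μ ν = transportCost μ ν ^ (1 / 2 : ℝ) := rfl

theorem transportCost_eq (μ ν : Measure X) : transportCost μ ν = W2 μ ν ^ 2 := by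
  rw [W2_eq, ← ENNReal.rpow_natCast, ← ENNReal.rpow_mul]
  norm_num

variable [SecondCountableTopology X]

theorem transportCost_ne_top {μ ν : Measure X} [IsProbabilityMeasure μ] [IsProbabilityMeasure ν]
    {x₀ : X} {r R : ℝ} (hμ : μ (Metric.ball x₀ r)ᶜ = 0) (hν : ν (Metric.ball x₀ R)ᶜ = 0) :
    transportCost μ ν ≠ ∞ := by
  have hc : IsCoupling (μ.prod ν) μ ν := ⟨Measure.map_fst_prod.trans (by simp),
    Measure.map_snd_prod.trans (by simp)⟩
  refine ne_top_of_le_ne_top (b := ENNReal.ofReal ((r + R) ^ 2)) ENNReal.ofReal_ne_top ?_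
  refine (transportCost_le hc).trans ?_
  have h1 : ∀ᵐ p ∂(μ.prod ν), p.1 ∈ Metric.ball x₀ r :=
    Measure.quasiMeasurePreserving_fst.ae (p := fun x => x ∈ Metric.ball x₀ r) hμ
  have h2 : ∀ᵐ p ∂(μ.prod ν), p.2 ∈ Metric.ball x₀ R :=
    Measure.quasiMeasurePreserving_snd.ae (p := fun x => x ∈ Metric.ball x₀ R) hν
  calc ∫⁻ p, edist p.1 p.2 ^ 2 ∂(μ.prod ν)
      ≤ ∫⁻ _, ENNReal.ofReal ((r + R) ^ 2) ∂(μ.prod ν) := by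
        apply lintegral_mono_ae
        filter_upwards [h1, h2] with p hp1 hp2
        rw [edist_sq_eq_ofReal]
        apply ENNReal.ofReal_le_ofReal
        apply pow_le_pow_left₀ dist_nonneg
        rw [Metric.mem_ball] at hp1 hp2
        linarith [dist_triangle_right p.1 p.2 x₀]
    _ = _ := by simp

variable [BorelSpace X]

/-- Concatenating a plan from `μ₀` to `ν` with a plan from `ν` to `μ₁`: the excess over the
optimal cost controls the mass which `ν` gives to points that are too far from `x₀`. -/
theorem transportCost_add_le_of_isCoupling [CompleteSpace X] {μ₀ ν μ₁ : Measure X}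
    [IsFiniteMeasure ν] {x₀ : X} {r R s t : ℝ}
    (hμ₀ : μ₀ (Metric.ball x₀ r)ᶜ = 0) (hμ₁ : μ₁ (Metric.ball x₀ R)ᶜ = 0)
    (ht0 : 0 < t) (ht1 : t < 1) (hs : r + t * (r + R) ≤ s)
    {π₁ π₂ : Measure (X × X)} (h₁ : IsCoupling π₁ μ₀ ν) (h₂ : IsCoupling π₂ ν μ₁) :
    transportCost μ₀ μ₁ + ENNReal.ofReal ((1 - t) / t * (s - (r + t * (r + R))) ^ 2)
        * ν (Metric.ball x₀ s)ᶜ ≤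
      ENNReal.ofReal (1 / t) * ∫⁻ p, edist p.1 p.2 ^ 2 ∂π₁
        + ENNReal.ofReal (1 / (1 - t)) * ∫⁻ p, edist p.1 p.2 ^ 2 ∂π₂ := by
  have : Nonempty X := ⟨x₀⟩
  have : IsFiniteMeasure π₁ := by
    refine ⟨?_⟩
    have := measure_lt_top ν univ
    rwa [← h₁.snd_eq, Measure.map_apply measurable_snd .univ] at this
  have : IsFiniteMeasure π₂ := by
    refine ⟨?_⟩
    have := measure_lt_top ν univ
    rwa [← h₂.fst_eq, Measure.map_apply measurable_fst .univ] at this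
  obtain ⟨P, hP1, hP2⟩ := exists_glue π₁ π₂ (h₁.snd_eq.trans h₂.fst_eq.symm)
  set δ : ℝ := (1 - t) / t * (s - (r + t * (r + R))) ^ 2
  have hx : P.map (fun p => p.1) = μ₀ := by
    rw [← h₁.fst_eq, ← hP1, Measure.map_map (by fun_prop) (by fun_prop)]
    rfl
  have hz : P.map (fun p => p.2.1) = ν := by
    rw [← h₂.fst_eq, ← hP2, Measure.map_map (by fun_prop) (by fun_prop)]
    rfl
  have hy : P.map (fun p => p.2.2) = μ₁ := by
    rw [← h₂.snd_eq, ← hP2, Measure.map_map (by fun_prop) (by fun_prop)]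
    rfl
  have hxy : IsCoupling (P.map (fun p => (p.1, p.2.2))) μ₀ μ₁ := by
    constructor
    · rw [← hx, Measure.map_map (by fun_prop) (by fun_prop)]
      rfl
    · rw [← hy, Measure.map_map (by fun_prop) (by fun_prop)]
      rfl
  have hcost : Measurable fun p : X × X => edist p.1 p.2 ^ 2 := by fun_prop
  have hbad : MeasurableSet {p : X × X × X | p.2.1 ∈ (Metric.ball x₀ s)ᶜ} :=
    Metric.isOpen_ball.measurableSet.compl.preimage
      (by fun_prop : Measurable fun p : X × X × X => p.2.1)
  have hax : ∀ᵐ p ∂P, p.1 ∈ Metric.ball x₀ r := by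
    refine ae_of_ae_map (f := fun p : X × X × X => p.1) (by fun_prop)
      (p := fun x => x ∈ Metric.ball x₀ r) ?_
    rw [hx]
    exact hμ₀
  have hay : ∀ᵐ p ∂P, p.2.2 ∈ Metric.ball x₀ R := by
    refine ae_of_ae_map (f := fun p : X × X × X => p.2.2) (by fun_prop)
      (p := fun x => x ∈ Metric.ball x₀ R) ?_
    rw [hy]
    exact hμ₁
  calc transportCost μ₀ μ₁ + ENNReal.ofReal δ * ν (Metric.ball x₀ s)ᶜ
      ≤ ∫⁻ p, edist p.1 p.2.2 ^ 2 ∂P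
          + ∫⁻ p, {p : X × X × X | p.2.1 ∈ (Metric.ball x₀ s)ᶜ}.indicator
              (fun _ => ENNReal.ofReal δ) p ∂P := by
        rw [lintegral_indicator_const hbad]
        gcongr
        · refine (transportCost_le hxy).trans ?_
          rw [lintegral_map hcost (by fun_prop)]
        · rw [← hz, Measure.map_apply (by fun_prop) Metric.isOpen_ball.measurableSet.compl]
          rfl
    _ = ∫⁻ p, (edist p.1 p.2.2 ^ 2
          + {p : X × X × X | p.2.1 ∈ (Metric.ball x₀ s)ᶜ}.indicator
              (fun _ => ENNReal.ofReal δ) p) ∂P := by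
        rw [lintegral_add_left (by fun_prop)]
    _ ≤ ∫⁻ p, (ENNReal.ofReal (1 / t) * edist p.1 p.2.1 ^ 2
          + ENNReal.ofReal (1 / (1 - t)) * edist p.2.1 p.2.2 ^ 2) ∂P := by
        apply lintegral_mono_ae
        filter_upwards [hax, hay] with ⟨x, z, y⟩ hpx hpy
        simp only [Metric.mem_ball] at hpx hpy
        have h1t : 0 < 1 - t := by linarith
        simp only [edist_sq_eq_ofReal]
        rw [← ENNReal.ofReal_mul (by positivity), ← ENNReal.ofReal_mul (by positivity),
          ← ENNReal.ofReal_add (by positivity) (by positivity)]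
        by_cases hzs : z ∈ Metric.ball x₀ s
        · rw [indicator_of_notMem (by simpa using hzs), add_zero]
          exact ENNReal.ofReal_le_ofReal
            (sq_le_sq_div_add_sq_div ht0 ht1 dist_nonneg (dist_triangle _ _ _))
        · rw [indicator_of_mem (by simpa using hzs),
            ← ENNReal.ofReal_add (by positivity) (by positivity)]
          apply ENNReal.ofReal_le_ofReal
          simp only [Metric.mem_ball, not_lt] at hzs
          -- Here `dist x y ≤ r + R`, while `z` outside `B_s(x₀)` gives `dist x z ≥ s - r`; the
          -- excess `η` is `s - r - t (r + R)`.
          refine sq_add_le_sq_div_add_sq_div (D := r + R) ht0 ht1 dist_nonneg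
            (dist_triangle _ _ _) ?_ (by linarith) ?_
          · linarith [dist_triangle_right x y x₀]
          · linarith [dist_triangle_left z x₀ x]
    _ = _ := by
        rw [lintegral_add_left (by fun_prop), lintegral_const_mul _ (by fun_prop),
          lintegral_const_mul _ (by fun_prop), ← hP1, ← hP2, lintegral_map hcost (by fun_prop),
          lintegral_map hcost (by fun_prop)]

/-- Intermediate measures of a Wasserstein geodesic between measures concentrated on two
concentric balls are concentrated on a ball of controlled radius. -/
theorem IsW2Geodesic.measure_compl_ball_eq_zero [CompleteSpace X] {γ : ℝ → Measure X}
    {μ₀ μ₁ : Measure X} [IsProbabilityMeasure μ₀] [IsProbabilityMeasure μ₁]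
    (hγ : IsW2Geodesic γ μ₀ μ₁) {x₀ : X} {r R s t : ℝ}
    (hμ₀ : μ₀ (Metric.ball x₀ r)ᶜ = 0) (hμ₁ : μ₁ (Metric.ball x₀ R)ᶜ = 0)
    (ht0 : 0 < t) (ht1 : t < 1) (hs : r + t * (r + R) < s) :
    γ t (Metric.ball x₀ s)ᶜ = 0 := by
  have h1t : 0 < 1 - t := by linarith
  have htm : t ∈ Icc (0 : ℝ) 1 := ⟨ht0.le, ht1.le⟩
  have := (hγ.mem t htm).isProbabilityMeasure
  set I := transportCost μ₀ μ₁
  have hI : I ≠ ∞ := transportCost_ne_top hμ₀ hμ₁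
  have hc0 : transportCost μ₀ (γ t) = ENNReal.ofReal (t ^ 2) * I := by
    have := hγ.dist_eq 0 (by simp) t htm
    rw [hγ.start, sub_zero, abs_of_pos ht0] at this
    rw [transportCost_eq, this, mul_pow, ← transportCost_eq, ENNReal.ofReal_pow ht0.le]
  have hc1 : transportCost (γ t) μ₁ = ENNReal.ofReal ((1 - t) ^ 2) * I := by
    have := hγ.dist_eq t htm 1 (by simp)
    rw [hγ.finish, abs_of_pos h1t] at this
    rw [transportCost_eq, this, mul_pow, ← transportCost_eq, ENNReal.ofReal_pow h1t.le]
  set δ : ℝ := (1 - t) / t * (s - (r + t * (r + R))) ^ 2 with hδ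
  have hδ0 : 0 < δ := by
    have : 0 < s - (r + t * (r + R)) := by linarith
    positivity
  set K := I + ENNReal.ofReal δ * γ t (Metric.ball x₀ s)ᶜ with hK
  have hinv : ∀ u : ℝ, 0 < u → ENNReal.ofReal u * ENNReal.ofReal (1 / u) = 1 := by
    intro u hu
    rw [← ENNReal.ofReal_mul hu.le, mul_one_div_cancel hu.ne', ENNReal.ofReal_one]
  have key : K ≤ ENNReal.ofReal (1 / t) * transportCost μ₀ (γ t)
      + ENNReal.ofReal (1 / (1 - t)) * transportCost (γ t) μ₁ := by
    have hne : ∀ u : ℝ, 0 < u → ENNReal.ofReal (1 / u) ≠ 0 := by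
      intro u hu
      simpa using hu
    -- The excess bound holds for arbitrary plans, so both infima can be taken and no optimal plan
    -- is needed.
    simp only [transportCost, ENNReal.mul_iInf_of_ne (hne _ ht0) ENNReal.ofReal_ne_top,
      ENNReal.mul_iInf_of_ne (hne _ h1t) ENNReal.ofReal_ne_top]
    rw [← tsub_le_iff_right]
    refine le_iInf₂ fun π₁ h₁ => ?_
    rw [tsub_le_iff_left, ← tsub_le_iff_right]
    refine le_iInf₂ fun π₂ h₂ => ?_
    rw [tsub_le_iff_left]
    exact transportCost_add_le_of_isCoupling hμ₀ hμ₁ ht0 ht1 hs.le h₁ h₂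
  -- The two legs cost `t² I` and `(1 - t)² I`, so the weighted sum is exactly `I` and leaves no
  -- room for mass outside the ball.
  have hsum : ENNReal.ofReal (1 / t) * transportCost μ₀ (γ t)
      + ENNReal.ofReal (1 / (1 - t)) * transportCost (γ t) μ₁ = I := by
    rw [hc0, hc1, ← mul_assoc, ← mul_assoc, ← ENNReal.ofReal_mul (by positivity),
      ← ENNReal.ofReal_mul (by positivity), ← add_mul,
      ← ENNReal.ofReal_add (by positivity) (by positivity)]
    have : 1 / t * t ^ 2 + 1 / (1 - t) * (1 - t) ^ 2 = 1 := by
      field_simp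
      ring
    rw [this, ENNReal.ofReal_one, one_mul]
  rw [hsum, hK] at key
  have h0 : ENNReal.ofReal δ * γ t (Metric.ball x₀ s)ᶜ = 0 := by
    have : I + ENNReal.ofReal δ * γ t (Metric.ball x₀ s)ᶜ ≤ I + 0 := by simpa using key
    simpa using (ENNReal.add_le_add_iff_left hI).1 this
  rcases mul_eq_zero.1 h0 with h | h
  · simp [hδ0.not_ge] at h
  · exact h

end Transport

/-- The tangent line inequality for `u ↦ u log u` at the point `a⁻¹`. -/
theorem sub_mul_log_le_mul_log {a u : ℝ} (ha : 0 < a) (hu : 0 ≤ u) :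
    u - a⁻¹ - u * Real.log a ≤ u * Real.log u := by
  rcases hu.eq_or_lt with rfl | hu
  · simpa using ha.le
  · have h := Real.one_sub_inv_le_log_of_pos (mul_pos hu ha)
    rw [Real.log_mul hu.ne' ha.ne'] at h
    have h2 := mul_le_mul_of_nonneg_left h hu.le
    have : u * (1 - (u * a)⁻¹) = u - a⁻¹ := by
      field_simp
    linarith

/-! ### Entropy bounds, Brunn–Minkowski and finiteness of balls -/

section Entropy

variable {X : Type*} [MeasurableSpace X]

/-- Jensen's inequality for the entropy of a probability measure concentrated on a set of finite
measure. -/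
theorem neg_log_measure_le_relEntropy (m μ : Measure X) [SigmaFinite m] [IsProbabilityMeasure μ]
    {B : Set X} (hB : MeasurableSet B) (hμB : μ Bᶜ = 0) (hB0 : m B ≠ 0) (hBt : m B ≠ ∞) :
    ((-Real.log (m B).toReal : ℝ) : EReal) ≤ relEntropy m μ := by
  unfold relEntropy
  split_ifs with h
  swap
  · exact le_top
  obtain ⟨hac, hpos⟩ := h
  set ρ : X → ℝ := fun x => (μ.rnDeriv m x).toReal with hρ
  set a := (m B).toReal with ha_def
  have ha : 0 < a := ENNReal.toReal_pos hB0 hBt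
  have hρm : Measurable ρ := (μ.measurable_rnDeriv m).ennreal_toReal
  have hφm : Measurable fun x => ρ x * Real.log (ρ x) := by fun_prop
  have hout : ∀ᵐ x ∂m, x ∉ B → ρ x = 0 := by
    have h0 : ∫⁻ x in Bᶜ, μ.rnDeriv m x ∂m = 0 := by
      rw [Measure.setLIntegral_rnDeriv hac, hμB]
    rw [lintegral_eq_zero_iff (μ.measurable_rnDeriv m)] at h0
    have h1 := (ae_restrict_iff' hB.compl).1 h0
    filter_upwards [h1] with x hx hxB
    simp [hρ, hx hxB]
  have hρ0 : ∀ x, 0 ≤ ρ x := fun x => ENNReal.toReal_nonneg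
  -- Since `u log u ≥ u - 1 ≥ -1`, the negative part is at most the indicator of `B`.
  have hneg : ∫⁻ x, ENNReal.ofReal (-(ρ x * Real.log (ρ x))) ∂m ≠ ∞ := by
    have hle : ∫⁻ x, ENNReal.ofReal (-(ρ x * Real.log (ρ x))) ∂m ≤ ∫⁻ x, B.indicator 1 x ∂m := by
      apply lintegral_mono_ae
      filter_upwards [hout] with x hx
      by_cases hxB : x ∈ B
      · rw [indicator_of_mem hxB, Pi.one_apply, ENNReal.ofReal_le_one]
        have := sub_mul_log_le_mul_log one_pos (hρ0 x)
        have := hρ0 x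
        simp only [Real.log_one, inv_one] at *
        linarith
      · simp [hx hxB]
    refine ne_top_of_le_ne_top ?_ hle
    rwa [lintegral_indicator_one hB]
  have hint : Integrable (fun x => ρ x * Real.log (ρ x)) m := by
    refine ⟨hφm.aestronglyMeasurable, ?_⟩
    rw [hasFiniteIntegral_iff_norm]
    have hle : ∫⁻ x, ENNReal.ofReal ‖ρ x * Real.log (ρ x)‖ ∂m
        ≤ ∫⁻ x, (ENNReal.ofReal (ρ x * Real.log (ρ x))
          + ENNReal.ofReal (-(ρ x * Real.log (ρ x)))) ∂m := by
      apply lintegral_mono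
      intro x
      dsimp only
      rcases le_total 0 (ρ x * Real.log (ρ x)) with h | h
      · rw [Real.norm_of_nonneg h]
        exact le_self_add
      · rw [Real.norm_of_nonpos h]
        exact le_add_self
    refine hle.trans_lt ?_
    rw [lintegral_add_left (by fun_prop)]
    exact ENNReal.add_lt_top.2 ⟨hpos.lt_top, hneg.lt_top⟩
  have hρint : Integrable ρ m := Measure.integrable_toReal_rnDeriv
  have hρ1 : ∫ x, ρ x ∂m = 1 := by
    rw [hρ, Measure.integral_toReal_rnDeriv hac]
    simp
  have hBint : Integrable (B.indicator fun _ => a⁻¹) m :=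
    (integrable_indicator_iff hB).2 (integrableOn_const hBt)
  -- Integrating the tangent line at `a⁻¹` over `B`, the terms `∫ ρ` and `a⁻¹ m(B)` are both `1` and
  -- cancel.
  have hreal : -Real.log a ≤ ∫ x, ρ x * Real.log (ρ x) ∂m := by
    calc -Real.log a = ∫ x, (ρ x - B.indicator (fun _ => a⁻¹) x - ρ x * Real.log a) ∂m := by
          rw [integral_sub (f := fun x => ρ x - B.indicator (fun _ => a⁻¹) x) (hρint.sub hBint)
              (hρint.mul_const _), integral_sub hρint hBint,
            integral_mul_const, hρ1, integral_indicator_const _ hB]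
          simp [measureReal_def, ← ha_def, ha.ne']
      _ ≤ _ := by
          apply integral_mono_ae ((hρint.sub hBint).sub (hρint.mul_const _)) hint
          filter_upwards [hout] with x hx
          by_cases hxB : x ∈ B
          · simpa [hxB] using sub_mul_log_le_mul_log ha (hρ0 x)
          · simp [hxB, hx hxB]
  rw [integral_eq_lintegral_pos_part_sub_lintegral_neg_part hint] at hreal
  refine (EReal.coe_le_coe_iff.2 hreal).trans ?_
  rw [EReal.coe_sub, EReal.coe_ennreal_toReal hpos, EReal.coe_ennreal_toReal hneg]

/-- The uniform measure has constant density on `A`, which is the equality case of Jensen's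
inequality. -/
theorem relEntropy_cond (m : Measure X) [SigmaFinite m]
    {A : Set X} (hA : MeasurableSet A) (hA0 : m A ≠ 0) (hAt : m A ≠ ∞) :
    relEntropy m (ProbabilityTheory.cond m A) = ((-Real.log (m A).toReal : ℝ) : EReal) := by
  set a := (m A).toReal with ha_def
  have ha : 0 < a := ENNReal.toReal_pos hA0 hAt
  have hac : ProbabilityTheory.cond m A ≪ m := ProbabilityTheory.cond_absolutelyContinuous
  have hrn : (ProbabilityTheory.cond m A).rnDeriv m =ᵐ[m] A.indicator fun _ => (m A)⁻¹ := by
    have : ProbabilityTheory.cond m A = m.withDensity (A.indicator fun _ => (m A)⁻¹) := by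
      rw [withDensity_indicator hA, withDensity_const]
      rfl
    rw [this]
    exact Measure.rnDeriv_withDensity m (measurable_const.indicator hA)
  -- Vanishing of `g` at `0` removes the complement of `A`; both signs of `u log u` are covered.
  have hcomp : ∀ g : ℝ → ℝ, g 0 = 0 →
      ∫⁻ x, ENNReal.ofReal (g ((ProbabilityTheory.cond m A).rnDeriv m x).toReal) ∂m
        = ENNReal.ofReal (g a⁻¹) * m A := by
    intro g hg
    rw [← lintegral_indicator_const hA]
    apply lintegral_congr_ae
    filter_upwards [hrn] with x hx
    rw [hx]
    by_cases hxA : x ∈ A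
    · simp [hxA, ha_def]
    · simp [hxA, hg]
  have hA' : m A = ENNReal.ofReal a := (ENNReal.ofReal_toReal hAt).symm
  have hfin : ∀ g : ℝ → ℝ, ENNReal.ofReal (g a⁻¹) * m A = ENNReal.ofReal (g a⁻¹ * a) := by
    intro g
    rw [hA', ENNReal.ofReal_mul' ha.le]
  have h1 := (hcomp (fun u => u * Real.log u) (by simp)).trans (hfin fun u => u * Real.log u)
  have h2 := (hcomp (fun u => -(u * Real.log u)) (by simp)).trans
    (hfin fun u => -(u * Real.log u))
  have e1 : a⁻¹ * Real.log a⁻¹ * a = -Real.log a := by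
    rw [Real.log_inv]
    field_simp
  have e2 : -(a⁻¹ * Real.log a⁻¹) * a = Real.log a := by
    rw [Real.log_inv]
    field_simp
  simp only [e1, e2] at h1 h2
  rw [relEntropy, h1, h2, if_pos ⟨hac, ENNReal.ofReal_ne_top⟩, EReal.coe_ennreal_ofReal,
    EReal.coe_ennreal_ofReal, ← EReal.coe_sub]
  congr 1
  rcases le_total 0 (Real.log a) with h | h
  · rw [max_eq_right (by linarith), max_eq_left h]
    ring
  · rw [max_eq_left (by linarith), max_eq_right h]
    ring

variable [MetricSpace X]

theorem isP2_of_measure_compl_ball_eq_zero {μ : Measure X} [IsProbabilityMeasure μ] {x₀ : X}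
    {r : ℝ} (h : μ (Metric.ball x₀ r)ᶜ = 0) : IsP2 μ := by
  refine ⟨inferInstance, x₀, ?_⟩
  have h' : ∀ᵐ x ∂μ, x ∈ Metric.ball x₀ r := h
  calc ∫⁻ x, edist x x₀ ^ 2 ∂μ ≤ ∫⁻ _, ENNReal.ofReal (r ^ 2) ∂μ := by
        apply lintegral_mono_ae
        filter_upwards [h'] with x hx
        rw [edist_sq_eq_ofReal]
        exact ENNReal.ofReal_le_ofReal (pow_le_pow_left₀ dist_nonneg (Metric.mem_ball.1 hx).le 2)
    _ < ∞ := by simp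

variable [CompleteSpace X] [SecondCountableTopology X] [BorelSpace X]

/-- Brunn–Minkowski inequality for a ball and a subset of a concentric ball. -/
theorem IsCDZeroInfty.log_measure_ball_le {m : Measure X} [IsLocallyFiniteMeasure m]
    [m.IsOpenPosMeasure] (hCD : IsCDZeroInfty m) {x₀ : X} {r R s t : ℝ} (hr : 0 < r)
    (hrt : m (Metric.ball x₀ r) ≠ ∞) {A : Set X} (hA : MeasurableSet A)
    (hAR : A ⊆ Metric.ball x₀ R) (hA0 : m A ≠ 0) (hAt : m A ≠ ∞)
    (ht0 : 0 < t) (ht1 : t < 1) (hs : r + t * (r + R) < s) (hst : m (Metric.ball x₀ s) ≠ ∞) :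
    (1 - t) * Real.log (m (Metric.ball x₀ r)).toReal + t * Real.log (m A).toReal
      ≤ Real.log (m (Metric.ball x₀ s)).toReal := by
  have hr0 : m (Metric.ball x₀ r) ≠ 0 := (Metric.measure_ball_pos m x₀ hr).ne'
  have hR : 0 < R := by
    by_contra hR
    rw [Metric.ball_eq_empty.2 (not_lt.1 hR), subset_empty_iff] at hAR
    simp [hAR] at hA0
  have hs0 : m (Metric.ball x₀ s) ≠ 0 := by
    refine (Metric.measure_ball_pos m x₀ ?_).ne'
    have : 0 < t * (r + R) := by positivity
    linarith
  have hB := (Metric.isOpen_ball (x := x₀) (ε := r)).measurableSet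
  have := ProbabilityTheory.cond_isProbabilityMeasure_of_finite hr0 hrt
  have := ProbabilityTheory.cond_isProbabilityMeasure_of_finite hA0 hAt
  have hconc : ∀ {S T : Set X}, MeasurableSet S → S ⊆ T → ProbabilityTheory.cond m S Tᶜ = 0 := by
    intro S T hS hST
    rw [ProbabilityTheory.cond_apply hS, (disjoint_compl_right_iff_subset.2 hST).inter_eq]
    simp
  have h0 := hconc hB (subset_refl (Metric.ball x₀ r))
  have h1 := hconc hA hAR
  obtain ⟨γ, hγ, hent⟩ := hCD _ _ (isP2_of_measure_compl_ball_eq_zero h0)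
    (isP2_of_measure_compl_ball_eq_zero h1)
  have htm : t ∈ Icc (0 : ℝ) 1 := ⟨ht0.le, ht1.le⟩
  have hγs := hγ.measure_compl_ball_eq_zero h0 h1 ht0 ht1 hs
  have := (hγ.mem t htm).isProbabilityMeasure
  have key := (neg_log_measure_le_relEntropy m (γ t) Metric.isOpen_ball.measurableSet hγs hs0
    hst).trans (hent t htm)
  rw [relEntropy_cond m hB hr0 hrt, relEntropy_cond m hA hA0 hAt] at key
  norm_cast at key
  linarith

/-- Mass moved for a short time `t` stays in a small ball of finite measure, and this bounds the
measure of every finite-measure subset of `B_R(x₀)`. -/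
theorem IsCDZeroInfty.measure_ball_ne_top {m : Measure X} [IsLocallyFiniteMeasure m]
    [m.IsOpenPosMeasure] (hCD : IsCDZeroInfty m) (x₀ : X) (R : ℝ) : m (Metric.ball x₀ R) ≠ ∞ := by
  intro htop
  obtain ⟨s, hs, hst⟩ : ∃ s > 0, m (Metric.ball x₀ s) ≠ ∞ := by
    obtain ⟨U, hU, hUt⟩ := m.finiteAt_nhds x₀
    obtain ⟨s, hs, hsU⟩ := Metric.mem_nhds_iff.1 hU
    exact ⟨s, hs, ((measure_mono hsU).trans_lt hUt).ne⟩
  have hsR : s < R := by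
    by_contra h
    exact hst (top_unique (htop ▸ measure_mono (Metric.ball_subset_ball (not_lt.1 h))))
  set r := s / 2 with hr
  have hr0 : 0 < r := by positivity
  have hrt : m (Metric.ball x₀ r) ≠ ∞ :=
    ne_top_of_le_ne_top hst (measure_mono (Metric.ball_subset_ball (by linarith)))
  have hR : 0 < R := hs.trans hsR
  obtain ⟨t, ht0, ht1, hts⟩ : ∃ t : ℝ, 0 < t ∧ t < 1 ∧ r + t * (r + R) < s := by
    -- With this `t`, `r + t (r + R) = 3r/2 < 2r = s`.
    refine ⟨r / (2 * (r + R)), by positivity, ?_, ?_⟩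
    · rw [div_lt_one (by positivity)]
      linarith
    · have : r / (2 * (r + R)) * (r + R) = r / 2 := by
        have : r + R ≠ 0 := by positivity
        field_simp
      linarith
  set V := Real.log (m (Metric.ball x₀ s)).toReal
  set v := Real.log (m (Metric.ball x₀ r)).toReal
  -- Chosen so that `m(A) > C` makes `t log m(A)` exceed `V - (1 - t) v`, contradicting
  -- Brunn–Minkowski.
  set C := Real.exp ((V - (1 - t) * v) / t + 1) with hC
  obtain ⟨A, hAR, hA, hAC, hAt⟩ := Measure.exists_subset_measure_lt_top
    (μ := m) (Metric.isOpen_ball (x := x₀) (ε := R)).measurableSet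
    (r := ENNReal.ofReal C) (by rw [htop]; exact ENNReal.ofReal_lt_top)
  have hA0 : m A ≠ 0 := (zero_le.trans_lt hAC).ne'
  have key := hCD.log_measure_ball_le hr0 hrt hAR hA hA0 hAt.ne ht0 ht1 hts hst
  have hlog : (V - (1 - t) * v) / t + 1 < Real.log (m A).toReal := by
    rw [Real.lt_log_iff_exp_lt (ENNReal.toReal_pos hA0 hAt.ne)]
    exact (ENNReal.ofReal_lt_iff_lt_toReal (Real.exp_pos _).le hAt.ne).1 hAC
  have h2 : t * ((V - (1 - t) * v) / t + 1) = V - (1 - t) * v + t := by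
    field_simp
  nlinarith [mul_lt_mul_of_pos_left hlog ht0]

end Entropy

/-! ### Linear growth from asymptotic concavity -/

open scoped NNReal

/-- A real function bounded below whose increments from `r₀` satisfy an asymptotic
concavity estimate grows at a linear rate. -/
theorem exists_tendsto_div_of_asymptotic_concave {v : ℝ → ℝ} {r₀ : ℝ} (hr₀ : 0 < r₀)
    (hv : ∀ s, r₀ < s → v r₀ ≤ v s)
    (h : ∀ s R, r₀ < s → s ≤ R →
      (v R - v r₀) / (R + 2 * r₀) ≤ (v s - v r₀) / (s - r₀)) :
    ∃ L : ℝ≥0, Tendsto (fun r => v r / r) atTop (𝓝 (L : ℝ)) := by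
  set g : ℝ → ℝ := fun s => (v s - v r₀) / (s - r₀) with hg
  have hg0 : ∀ y ∈ g '' Ioi r₀, 0 ≤ y := by
    rintro _ ⟨s, hs, rfl⟩
    exact div_nonneg (by linarith [hv s hs]) (by linarith [mem_Ioi.1 hs])
  set L := sInf (g '' Ioi r₀)
  have hL0 : 0 ≤ L := Real.sInf_nonneg hg0
  have hbdd : BddBelow (g '' Ioi r₀) := ⟨0, hg0⟩
  have hne : (g '' Ioi r₀).Nonempty := nonempty_Ioi.image g
  have hlin : ∀ c d : ℝ, Tendsto (fun R : ℝ => (R + c) / (R + d)) atTop (𝓝 1) := by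
    intro c d
    have h1 : Tendsto (fun R : ℝ => 1 + (c - d) / (R + d)) atTop (𝓝 (1 + 0)) :=
      tendsto_const_nhds.add
        (tendsto_const_nhds.div_atTop (tendsto_atTop_add_const_right _ _ tendsto_id))
    rw [add_zero] at h1
    refine h1.congr' ?_
    filter_upwards [eventually_gt_atTop (-d)] with R hR
    have : R + d ≠ 0 := by linarith
    field_simp
    ring
  -- Below, `g R ≥ L` gives `L (R - r₀) / (R + 2 r₀)`; above, the quotient is at most `g s` for any
  -- fixed `s`, and `g s` can be taken close to `L`.
  have hq : Tendsto (fun R => (v R - v r₀) / (R + 2 * r₀)) atTop (𝓝 L) := by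
    rw [tendsto_order]
    constructor
    · intro b hb
      have h1 : Tendsto (fun R : ℝ => L * ((R + -r₀) / (R + 2 * r₀))) atTop (𝓝 (L * 1)) :=
        (hlin _ _).const_mul L
      rw [mul_one] at h1
      filter_upwards [h1.eventually_const_lt hb, eventually_gt_atTop r₀] with R hR hRr
      refine hR.trans_le ?_
      have hLg : L ≤ g R := csInf_le hbdd ⟨R, hRr, rfl⟩
      have h2 : 0 < R - r₀ := by linarith
      rw [hg, le_div_iff₀ h2] at hLg
      rw [← mul_div_assoc]
      gcongr
      · linarith
      · rwa [← sub_eq_add_neg]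
    · intro b hb
      obtain ⟨_, ⟨s, hs, rfl⟩, hsb⟩ := exists_lt_of_csInf_lt hne hb
      filter_upwards [eventually_ge_atTop s] with R hR
      exact (h s R hs hR).trans_lt hsb
  refine ⟨⟨L, hL0⟩, ?_⟩
  have h1 := (hq.mul (hlin (2 * r₀) 0)).add
    (tendsto_const_nhds.div_atTop tendsto_id : Tendsto (fun R : ℝ => v r₀ / R) atTop (𝓝 0))
  rw [mul_one, add_zero] at h1
  refine h1.congr' ?_
  filter_upwards [eventually_gt_atTop 0] with R hR
  have : R + 2 * r₀ ≠ 0 := by positivity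
  rw [add_zero]
  field_simp
  ring

/-! ### Logarithmic volume growth and change of base point -/

section VolumeGrowth

variable {X : Type*} [MetricSpace X] [MeasurableSpace X]

/-- The logarithmic volume of the ball of radius `r` around `x`. -/
def logVolume (m : Measure X) (x : X) (r : ℝ) : ℝ := Real.log (m (Metric.ball x r)).toReal

theorem logVolume_mono {m : Measure X} [m.IsOpenPosMeasure]
    (hfin : ∀ (x : X) (r : ℝ), m (Metric.ball x r) ≠ ∞) {x y : X} {r s : ℝ} (hr : 0 < r)
    (hrs : r + dist x y ≤ s) : logVolume m x r ≤ logVolume m y s := by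
  refine Real.log_le_log (ENNReal.toReal_pos (Metric.measure_ball_pos m x hr).ne' (hfin x r)) ?_
  exact ENNReal.toReal_mono (hfin y s) (measure_mono (Metric.ball_subset_ball' hrs))

/-- `B_r(x) ⊆ B_{r+d}(y)` and `(r + d) / r → 1`. Exchanging `x` and `y` gives equality of the
limits. -/
theorem le_of_tendsto_logVolume_div {m : Measure X} [m.IsOpenPosMeasure]
    (hfin : ∀ (x : X) (r : ℝ), m (Metric.ball x r) ≠ ∞) {x y : X} {a b : ℝ}
    (hx : Tendsto (fun r => logVolume m x r / r) atTop (𝓝 a))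
    (hy : Tendsto (fun r => logVolume m y r / r) atTop (𝓝 b)) : a ≤ b := by
  set d := dist x y
  have h1 : Tendsto (fun r : ℝ => 1 + d / r) atTop (𝓝 (1 + 0)) :=
    tendsto_const_nhds.add (tendsto_const_nhds.div_atTop tendsto_id)
  have h2 := (hy.comp (tendsto_atTop_add_const_right _ d tendsto_id)).mul h1
  rw [add_zero, mul_one] at h2
  refine le_of_tendsto_of_tendsto hx h2 ?_
  filter_upwards [eventually_gt_atTop 0] with r hr
  have hd : 0 ≤ d := dist_nonneg
  have hrd : r + d ≠ 0 := by positivity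
  have : (logVolume m y (r + d) / (r + d)) * (1 + d / r) = logVolume m y (r + d) / r := by
    field_simp
  simp only [Function.comp, id, this]
  gcongr
  exact logVolume_mono hfin hr le_rfl

theorem hasVolumeEntropyAt_of_tendsto {m : Measure X} [m.IsOpenPosMeasure]
    (hfin : ∀ (x : X) (r : ℝ), m (Metric.ball x r) ≠ ∞) {x : X} {L : ℝ≥0}
    (hx : Tendsto (fun r => logVolume m x r / r) atTop (𝓝 (L : ℝ))) :
    HasVolumeEntropyAt m x L := by
  have h1 : Tendsto (fun r => ((logVolume m x r / r : ℝ) : EReal)) atTop (𝓝 ((L : ℝ) : EReal)) :=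
    (continuous_coe_real_ereal.tendsto _).comp hx
  refine h1.congr' ?_
  filter_upwards [eventually_gt_atTop 0] with r hr
  rw [ENNReal.log_pos_real (Metric.measure_ball_pos m x hr).ne' (hfin x r), EReal.coe_div]
  rfl

theorem IsCDZeroInfty.exists_tendsto_logVolume_div [CompleteSpace X] [SecondCountableTopology X]
    [BorelSpace X] {m : Measure X} [IsLocallyFiniteMeasure m] [m.IsOpenPosMeasure]
    (hCD : IsCDZeroInfty m) (x : X) :
    ∃ L : ℝ≥0, Tendsto (fun r => logVolume m x r / r) atTop (𝓝 (L : ℝ)) := by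
  have hfin := hCD.measure_ball_ne_top
  have hmono : ∀ s, 1 < s → logVolume m x 1 ≤ logVolume m x s := fun s hs =>
    logVolume_mono hfin one_pos (by simpa using hs.le)
  refine exists_tendsto_div_of_asymptotic_concave one_pos hmono fun s R hs hR => ?_
  have hR2 : 0 < R + 2 * 1 := by linarith
  have hs1 : 0 < s - 1 := by linarith
  have ht0 : 0 < (s - 1) / (R + 2 * 1) := by positivity
  have ht1 : (s - 1) / (R + 2 * 1) < 1 := by
    rw [div_lt_one hR2]
    linarith
  -- The denominator `R + 2` in place of `R + 1` provides the strict inequality required of the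
  -- radius.
  have hts : 1 + (s - 1) / (R + 2 * 1) * (1 + R) < s := by
    have : (s - 1) / (R + 2 * 1) * (R + 2 * 1) = s - 1 := div_mul_cancel₀ _ hR2.ne'
    nlinarith
  have key := hCD.log_measure_ball_le one_pos (hfin x 1) Metric.isOpen_ball.measurableSet
    subset_rfl (Metric.measure_ball_pos m x (by linarith : 0 < R)).ne' (hfin x R) ht0 ht1 hts
    (hfin x s)
  change (1 - _) * logVolume m x 1 + _ * logVolume m x R ≤ logVolume m x s at key
  rw [le_div_iff₀ hs1]
  have e : (logVolume m x R - logVolume m x 1) / (R + 2 * 1) * (s - 1)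
      = (s - 1) / (R + 2 * 1) * (logVolume m x R - logVolume m x 1) := by ring
  rw [e]
  linarith

end VolumeGrowth

end VolEntropy

end

theorem proposition3p2 {X : Type*} [MetricSpace X] [CompleteSpace X]
    [TopologicalSpace.SeparableSpace X] [NoncompactSpace X] [MeasurableSpace X] [BorelSpace X]
    (m : Measure X) [IsLocallyFiniteMeasure m] [m.IsOpenPosMeasure]
    (hCD : VolEntropy.IsCDZeroInfty m) :
    ∃ h : ℝ≥0∞, ∀ x₀ : X, VolEntropy.HasVolumeEntropyAt m x₀ h := by
  have : SecondCountableTopology X := UniformSpace.secondCountable_of_separable X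
  have hfin := hCD.measure_ball_ne_top
  choose L hL using hCD.exists_tendsto_logVolume_div
  -- An empty space would be compact.
  obtain ⟨x₁⟩ : Nonempty X := by
    by_contra h
    rw [not_nonempty_iff] at h
    exact not_compactSpace_iff.2 ‹_› inferInstance
  refine ⟨L x₁, fun x₀ => ?_⟩
  have hle : ∀ x y, L x ≤ L y := fun x y =>
    NNReal.coe_le_coe.1 (VolEntropy.le_of_tendsto_logVolume_div hfin (hL x) (hL y))
  rw [(hle x₁ x₀).antisymm (hle x₀ x₁)]
  exact VolEntropy.hasVolumeEntropyAt_of_tendsto hfin (hL x₀)
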